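/- \textbf{Syntax.} Let $\Sigma=(B,K,O,\mathrm{ar},\mathrm{car})$ be a $\lambda_c$-signature: a set $B$ of base types, a set $K$ of effect-free constants, a set $O$ of algebraic operations, and maps $\mathrm{ar},\mathrm{car}:K\sqcup O\to\mathbf{GTyp}(B)$. Types are $\rho,\tau ::= b\mid 1\mid\rho\times\tau\mid 0\mid\rho+\tau\mid\rho\to\tau$ with $b\in B$; the set $\mathbf{GTyp}(B)$ of ground types consists of those without $\to$. The terms are those of the simply typed $\lambda$-calculus with these types (variables, nullary and binary tuples, projections, injections, nullary and binary case analyses, abstractions, applications) together with $c\,M$ for $c\in K$ and $o_\rho\,M$ for $o\in O$, typed by: if $\Gamma\vdash M:\mathrm{ar}(c)$ then $\Gamma\vdash c\,M:\mathrm{car}(c)$; if $\Gamma\vdash M:(\mathrm{ar}(o)\to\rho)\times\mathrm{car}(o)$ then $\Gamma\vdash o_\rho\,M:\rho$ (for any type $\rho$). \textbf{Semantics.} For a strong monad $(T,\eta,\mu,\mathrm{st})$ on a bicartesian closed category $\mathbb C$, with strength $\mathrm{st}_{X,Y}:X\times TY\to T(X\times Y)$, a \emph{$(D,D')$-ary algebraic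 operation} is a natural transformation $o_X:(D\Rightarrow TX)\to(D'\Rightarrow TX)$ such that $o_X\circ(D\Rightarrow\mu_X)=(D'\Rightarrow\mu_X)\circ o_{TX}$ and $o_{X\times Y}\circ(D\Rightarrow\mathrm{st}_{X,Y})\circ\theta_{D}=(D'\Rightarrow\mathrm{st}_{X,Y})\circ\theta_{D'}\circ(X\times o_Y)$, where $\theta_{D}:X\times(D\Rightarrow TY)\to(D\Rightarrow X\times TY)$ is the canonical morphism. A \emph{$\lambda_c(\Sigma)$-structure} $\mathcal A=(\mathbb C,T,A,a)$ consists of a bicartesian closed category $\mathbb C$ (with chosen structure), a strong monad $T$ on it, an object $Ab\in\mathbb C$ for each $b\in B$, a morphism $a(c):\mathcal A[\![\mathrm{ar}(c)]\!]\to\mathcal A[\![\mathrm{car}(c)]\!]$ for each $c\in K$, and an $(\mathcal A[\![\mathrm{ar}(o)]\!],\mathcal A[\![\mathrm{car}(o)]\!])$-ary algebraic operation $a(o)$ for $T$ for each $o\in O$. Here $\mathcal A[\![b]\!]=Ab$, the type formers $1,\times,0,+$ are interpreted by the corresponding structure of $\mathbb C$, and $\mathcal A[\![\rho\to\tau]\!]=\mathcal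 A[\![\rho]\!]\Rightarrow T\mathcal A[\![\tau]\!]$. Contexts are interpreted by $\mathcal A[\![\cdot]\!]=1$, $\mathcal A[\![\Gamma,x:\rho]\!]=\mathcal A[\![\Gamma]\!]\times\mathcal A[\![\rho]\!]$, and well-typed terms $\Gamma\vdash M:\rho$ by the standard call-by-value (left-to-right) monadic semantics $\mathcal A[\![M]\!]:\mathcal A[\![\Gamma]\!]\to T\mathcal A[\![\rho]\!]$, with $\mathcal A[\![c\,M]\!]=T(a(c))\circ\mathcal A[\![M]\!]$ and $\mathcal A[\![o_\rho\,M]\!]=\mu\circ T(\Lambda^{-1}(a(o)_{\mathcal A[\![\rho]\!]}))\circ\mathcal A[\![M]\!]$, where $\Lambda$ denotes currying. \textbf{Fibrations.} A \emph{fibration for logical relations} is a functor $p:\mathbb E\to\mathbb C$ between bicartesian closed categories that is a fibration, all of whose fibre categories are posets, all of whose reindexing functors $u^*$ have left adjoints, whose fibres have small products preserved by all reindexing functors, and which strictly preserves the bicartesian closed structure. The structure of $\mathbb E$ is written with dots ($\dot\times,\dot\Rightarrow,\dots$). For $f:I\to J$ in $\mathbb C$ and $X,Y\in\mathbb E$ with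 $pX=I$ and $pY=J$, write $f:X\mathrel{\dot\to}Y$ if some morphism $X\to Y$ of $\mathbb E$ lies above $f$. \textbf{Lemma.} Let $\mathcal A=(\mathbb C,T,A,a)$ be a $\lambda_c(\Sigma)$-structure, let $p:\mathbb E\to\mathbb C$ be a fibration for logical relations, and let $V:B\to\mathbb E$ and $C:\mathbf{GTyp}(B)\to\mathbb E$ be assignments of objects with $p(Vb)=Ab$ for all $b\in B$ and $p(C\rho)=T\mathcal A[\![\rho]\!]$ for all $\rho\in\mathbf{GTyp}(B)$. Let $\mathcal V[\![-]\!]:\mathbf{GTyp}(B)\to\mathbb E$ be the extension of $V$ to ground types by the finite products and finite coproducts of $\mathbb E$. Assume that \begin{itemize} \item[(I)] $\eta_{\mathcal A[\![\rho]\!]}:\mathcal V[\![\rho]\!]\mathrel{\dot\to}C\rho$ for all $\rho\in\mathbf{GTyp}(B)$; \item[(C1)] $a(k):\mathcal V[\![\mathrm{ar}(k)]\!]\mathrel{\dot\to}\mathcal V[\![\mathrm{car}(k)]\!]$ for all $k\in K$; \item[(C2)] $a(o)_{\mathcal A[\![\rho]\!]}:(\mathcal V[\![\mathrm{ar}(o)]\!]\mathrel{\dot\Rightarrow}C\rho)\mathrel{\dot\to}(\mathcal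 V[\![\mathrm{car}(o)]\!]\mathrel{\dot\Rightarrow}C\rho)$ for all $o\in O$ and $\rho\in\mathbf{GTyp}(B)$. \end{itemize} Then for every well-typed term $x_1:b_1,\dots,x_n:b_n\vdash M:\rho$ with $n\ge 0$, $b_1,\dots,b_n\in B$ and $\rho\in\mathbf{GTyp}(B)$, $$\mathcal A[\![M]\!]:\dot\prod_{i=1}^n Vb_i\mathrel{\dot\to}C\rho.$$ -/

import Mathlib

open CategoryTheory CategoryTheory.Limits MonoidalCategory CartesianMonoidalCategory
open scoped CategoryTheory.CartesianClosed

universe w k o v u v' u'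

namespace LambdaC


section Bicartesian

/-- A choice of an initial object and of binary coproducts. A bicartesian closed category is a
category with instances of `CartesianMonoidalCategory`, `MonoidalClosed` and
`ChosenCoproducts`. -/
class ChosenCoproducts (C : Type u) [Category.{v} C] where
  /-- the initial object -/
  zero : C
  /-- its universal property -/
  isInitial : IsInitial zero
  /-- the binary coproduct -/
  sum : C → C → C
  /-- the first coprojection -/
  inl : ∀ X Y : C, X ⟶ sum X Y
  /-- the second coprojection -/
  inr : ∀ X Y : C, Y ⟶ sum X Y
  /-- its universal property -/
  isCoproduct : ∀ X Y : C, IsColimit (BinaryCofan.mk (inl X Y) (inr X Y))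

variable {C : Type u} [Category.{v} C]

section
variable [ChosenCoproducts C]

open ChosenCoproducts

/-- The unique morphism out of the initial object. -/
def fromZero (X : C) : (zero : C) ⟶ X := isInitial.to X

/-- The cotuple `[f, g]`. -/
def cotuple {X Y Z : C} (f : X ⟶ Z) (g : Y ⟶ Z) : sum X Y ⟶ Z :=
  (isCoproduct X Y).desc (BinaryCofan.mk f g)

@[simp]
theorem inl_cotuple {X Y Z : C} (f : X ⟶ Z) (g : Y ⟶ Z) : inl X Y ≫ cotuple f g = f :=
  (isCoproduct X Y).fac (BinaryCofan.mk f g) ⟨WalkingPair.left⟩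

@[simp]
theorem inr_cotuple {X Y Z : C} (f : X ⟶ Z) (g : Y ⟶ Z) : inr X Y ≫ cotuple f g = g :=
  (isCoproduct X Y).fac (BinaryCofan.mk f g) ⟨WalkingPair.right⟩

theorem sum_hom_ext {X Y Z : C} {f g : sum X Y ⟶ Z} (h₁ : inl X Y ≫ f = inl X Y ≫ g)
    (h₂ : inr X Y ≫ f = inr X Y ≫ g) : f = g :=
  BinaryCofan.IsColimit.hom_ext (isCoproduct X Y) h₁ h₂

end

section
variable [CartesianMonoidalCategory C]

/-- The symmetry `X × Y → Y × X`. -/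
def swap (X Y : C) : X ⊗ Y ⟶ Y ⊗ X := lift (snd X Y) (fst X Y)

variable [MonoidalClosed C]

/-- The bijection `Λ : C(X × Y, Z) → C(X, Y ⇒ Z)`. (Mathlib's `curry` abstracts over the left
factor of a product.) -/
def lam {X Y Z : C} (f : X ⊗ Y ⟶ Z) : X ⟶ (Y ⟹ Z) := MonoidalClosed.curry (swap Y X ≫ f)

/-- The inverse of `Λ`. -/
def unlam {X Y Z : C} (g : X ⟶ (Y ⟹ Z)) : X ⊗ Y ⟶ Z := swap X Y ≫ MonoidalClosed.uncurry g

/-- Evaluation `(X ⇒ Y) × X → Y`, the morphism `Λ⁻¹(id)`. -/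
def eval (X Y : C) : (X ⟹ Y) ⊗ X ⟶ Y := unlam (𝟙 (X ⟹ Y))

/-- The canonical morphism `X × (Y ⇒ Z) → (Y ⇒ X × Z)`, i.e. `Λ((X × ev) ∘ α)`. -/
def homStrength (X Y Z : C) : X ⊗ (Y ⟹ Z) ⟶ (Y ⟹ (X ⊗ Z)) :=
  lam ((α_ X (Y ⟹ Z) Y).hom ≫ X ◁ eval Y Z)

variable [ChosenCoproducts C]

open ChosenCoproducts

/-- The distributivity isomorphism whose underlying morphism is
`[id × ι₁, id × ι₂] : X × Y + X × Z → X × (Y + Z)`. -/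
def distrib (X Y Z : C) : sum (X ⊗ Y) (X ⊗ Z) ≅ X ⊗ sum Y Z where
  hom := cotuple (X ◁ inl Y Z) (X ◁ inr Y Z)
  inv := MonoidalClosed.uncurry
    (cotuple (MonoidalClosed.curry (inl (X ⊗ Y) (X ⊗ Z)))
      (MonoidalClosed.curry (inr (X ⊗ Y) (X ⊗ Z))))
  hom_inv_id := by
    apply sum_hom_ext
    · rw [← Category.assoc, inl_cotuple, ← MonoidalClosed.uncurry_natural_left, inl_cotuple,
        MonoidalClosed.uncurry_curry, Category.comp_id]
    · rw [← Category.assoc, inr_cotuple, ← MonoidalClosed.uncurry_natural_left, inr_cotuple,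
        MonoidalClosed.uncurry_curry, Category.comp_id]
  inv_hom_id := by
    apply MonoidalClosed.curry_injective
    rw [MonoidalClosed.curry_natural_right, MonoidalClosed.curry_uncurry]
    apply sum_hom_ext
    · rw [← Category.assoc, inl_cotuple, ← MonoidalClosed.curry_natural_right, inl_cotuple,
        ← MonoidalClosed.curry_natural_left, Category.comp_id]
    · rw [← Category.assoc, inr_cotuple, ← MonoidalClosed.curry_natural_right, inr_cotuple,
        ← MonoidalClosed.curry_natural_left, Category.comp_id]

end

end Bicartesian

section Monads

variable (C : Type u) [Category.{v} C] [CartesianMonoidalCategory C]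

/-- A strong monad on a cartesian monoidal category. -/
structure StrongMonad extends Monad C where
  /-- the strength `X × T Y → T (X × Y)` -/
  str : ∀ X Y : C, X ⊗ obj Y ⟶ obj (X ⊗ Y)
  str_naturality : ∀ {X X' Y Y' : C} (f : X ⟶ X') (g : Y ⟶ Y'),
    (f ⊗ₘ map g) ≫ str X' Y' = str X Y ≫ map (f ⊗ₘ g)
  str_leftUnitor : ∀ X : C, str (𝟙_ C) X ≫ map (λ_ X).hom = (λ_ (obj X)).hom
  str_associator : ∀ X Y Z : C,
    str (X ⊗ Y) Z ≫ map (α_ X Y Z).hom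
      = (α_ X Y (obj Z)).hom ≫ X ◁ str Y Z ≫ str X (Y ⊗ Z)
  str_unit : ∀ X Y : C, X ◁ η.app Y ≫ str X Y = η.app (X ⊗ Y)
  str_mult : ∀ X Y : C,
    X ◁ μ.app Y ≫ str X Y = str X (obj Y) ≫ map (str X Y) ≫ μ.app (X ⊗ Y)

variable {C}

namespace StrongMonad

variable (T : StrongMonad C)

/-- The double strength `T X × T Y → T (X × Y)` that runs the left computation first:
`μ ∘ T st ∘ T β ∘ st ∘ β`. -/
def dstr (X Y : C) : T.obj X ⊗ T.obj Y ⟶ T.obj (X ⊗ Y) :=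
  swap (T.obj X) (T.obj Y) ≫ T.str (T.obj Y) X ≫ T.map (swap (T.obj Y) X) ≫
    T.map (T.str X Y) ≫ T.μ.app (X ⊗ Y)

end StrongMonad

/-- A `(D, D')`-ary algebraic operation for `T`: a natural transformation
`(D ⇒ T X) → (D' ⇒ T X)` compatible with the strength and the multiplication. -/
structure AlgebraicOperation [MonoidalClosed C] (T : StrongMonad C) (D D' : C) where
  /-- the components -/
  app : ∀ X : C, (D ⟹ T.obj X) ⟶ (D' ⟹ T.obj X)
  naturality : ∀ {X Y : C} (f : X ⟶ Y),
    (ihom D).map (T.map f) ≫ app Y = app X ≫ (ihom D').map (T.map f)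
  app_str : ∀ X Y : C,
    homStrength X D (T.obj Y) ≫ (ihom D).map (T.str X Y) ≫ app (X ⊗ Y)
      = X ◁ app Y ≫ homStrength X D' (T.obj Y) ≫ (ihom D').map (T.str X Y)
  app_mult : ∀ X : C,
    (ihom D).map (T.μ.app X) ≫ app X = app (T.obj X) ≫ (ihom D').map (T.μ.app X)

end Monads

section Fibrations

variable {E : Type u'} [Category.{v'} E] {C : Type u} [Category.{v} C]

/-- `Above p f X Y` is the statement `f : X →̇ Y`: some morphism `X ⟶ Y` lies above `f`.
It includes that `X` and `Y` lie above the domain and the codomain of `f`. -/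
def Above (p : E ⥤ C) {I J : C} (f : I ⟶ J) (X Y : E) : Prop :=
  ∃ g : X ⟶ Y, p.IsHomLift f g

/-- The reindexing functor `f^* : E_J → E_I` of a fibration, for chosen cartesian liftings. -/
noncomputable def reindex (p : E ⥤ C) [p.IsFibered] {I J : C} (f : I ⟶ J) :
    p.Fiber J ⥤ p.Fiber I where
  obj Y := ⟨Functor.IsPreFibered.pullbackObj Y.2 f, Functor.IsPreFibered.pullbackObj_proj Y.2 f⟩
  map {Y Z} g :=
    haveI : p.IsHomLift (𝟙 J) g.1 := g.2
    ⟨Functor.IsCartesian.map p f (Functor.IsPreFibered.pullbackMap Z.2 f)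
      (Functor.IsPreFibered.pullbackMap Y.2 f ≫ g.1), inferInstance⟩
  map_id Y := by
    apply Subtype.ext
    symm
    have : p.IsHomLift (𝟙 J) (𝟙 Y : Y ⟶ Y).1 := (𝟙 Y : Y ⟶ Y).2
    have : p.IsHomLift (𝟙 I) (𝟙 (Functor.IsPreFibered.pullbackObj Y.2 f)) :=
      IsHomLift.id (Functor.IsPreFibered.pullbackObj_proj Y.2 f)
    apply Functor.IsCartesian.map_uniq p f
    exact (Category.id_comp _).trans (Category.comp_id _).symm
  map_comp {X Y Z} g h := by
    apply Subtype.ext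
    symm
    have : p.IsHomLift (𝟙 J) g.1 := g.2
    have : p.IsHomLift (𝟙 J) h.1 := h.2
    have : p.IsHomLift (𝟙 J) (g ≫ h).1 := (g ≫ h).2
    have : p.IsHomLift (𝟙 I)
        (Functor.IsCartesian.map p f (Functor.IsPreFibered.pullbackMap Y.2 f)
            (Functor.IsPreFibered.pullbackMap X.2 f ≫ g.1) ≫
          Functor.IsCartesian.map p f (Functor.IsPreFibered.pullbackMap Z.2 f)
            (Functor.IsPreFibered.pullbackMap Y.2 f ≫ h.1)) := inferInstance
    refine Functor.IsCartesian.map_uniq p f (Functor.IsPreFibered.pullbackMap Z.2 f) _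
      (Functor.IsCartesian.map p f (Functor.IsPreFibered.pullbackMap Y.2 f)
            (Functor.IsPreFibered.pullbackMap X.2 f ≫ g.1) ≫
          Functor.IsCartesian.map p f (Functor.IsPreFibered.pullbackMap Z.2 f)
            (Functor.IsPreFibered.pullbackMap Y.2 f ≫ h.1)) ?_
    change (Functor.IsCartesian.map p f _ _ ≫ Functor.IsCartesian.map p f _ _) ≫ _ = _ ≫ g.1 ≫ h.1
    rw [Category.assoc, Functor.IsCartesian.fac, Functor.IsCartesian.fac_assoc, Category.assoc]

variable [CartesianMonoidalCategory E] [MonoidalClosed E] [ChosenCoproducts E]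
variable [CartesianMonoidalCategory C] [MonoidalClosed C] [ChosenCoproducts C]

open ChosenCoproducts

/-- `p` strictly preserves the chosen bicartesian closed structure: it maps the structure objects
to the structure objects, and the projections, evaluations and coprojections to the projections,
evaluations and coprojections. (That `p.obj (X ⊗ Y) = p.obj X ⊗ p.obj Y`, and likewise for
coproducts, is part of `fst` and `inl`.) -/
structure StrictlyPreservesBCC (p : E ⥤ C) : Prop where
  one : p.obj (𝟙_ E) = 𝟙_ C
  fst : ∀ X Y : E, p.IsHomLift (fst (p.obj X) (p.obj Y)) (fst X Y)
  snd : ∀ X Y : E, p.IsHomLift (snd (p.obj X) (p.obj Y)) (snd X Y)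
  exp : ∀ X Y : E, p.obj (X ⟹ Y) = (p.obj X ⟹ p.obj Y)
  eval : ∀ X Y : E, p.IsHomLift (eval (p.obj X) (p.obj Y)) (eval X Y)
  zero : p.obj (zero : E) = (zero : C)
  inl : ∀ X Y : E, p.IsHomLift (inl (p.obj X) (p.obj Y)) (inl X Y)
  inr : ∀ X Y : E, p.IsHomLift (inr (p.obj X) (p.obj Y)) (inr X Y)

/-- A fibration for logical relations: a posetal bifibration with fibrewise small products
between bicartesian closed categories which strictly preserves the bicartesian closed structure.
`w` is the universe of small sets. -/
structure IsFibrationForLogicalRelations (p : E ⥤ C) : Prop where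
  isFibered : p.IsFibered
  thin : ∀ (I : C) (X Y : p.Fiber I) (f g : X ⟶ Y), f = g
  antisymm : ∀ (I : C) (X Y : p.Fiber I), (X ⟶ Y) → (Y ⟶ X) → X = Y
  bifibration : ∀ {I J : C} (f : I ⟶ J), (reindex p f).IsRightAdjoint
  hasProducts : ∀ I : C, HasProducts.{w} (p.Fiber I)
  preservesProducts : ∀ {I J : C} (f : I ⟶ J) (ι : Type w),
    PreservesLimitsOfShape (Discrete ι) (reindex p f)
  strict : StrictlyPreservesBCC p

end Fibrations

section Calculus

/-- Types over a set of base types. -/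
inductive Typ (B : Type w) : Type w
  | base : B → Typ B
  | one : Typ B
  | prod : Typ B → Typ B → Typ B
  | zero : Typ B
  | sum : Typ B → Typ B → Typ B
  | arr : Typ B → Typ B → Typ B

/-- Ground types over a set of base types. -/
inductive GTyp (B : Type w) : Type w
  | base : B → GTyp B
  | one : GTyp B
  | prod : GTyp B → GTyp B → GTyp B
  | zero : GTyp B
  | sum : GTyp B → GTyp B → GTyp B

/-- The inclusion of ground types into types. -/
def GTyp.toTyp {B : Type w} : GTyp B → Typ B
  | .base b => .base b
  | .one => .one
  | .prod ρ τ => .prod ρ.toTyp τ.toTyp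
  | .zero => .zero
  | .sum ρ τ => .sum ρ.toTyp τ.toTyp

/-- A `λ_c`-signature: base types, effect-free constants and algebraic operations, with arities
and coarities. -/
structure Signature where
  /-- base types -/
  B : Type w
  /-- effect-free constants -/
  K : Type k
  /-- algebraic operations -/
  O : Type o
  /-- arities -/
  ar : K ⊕ O → GTyp B
  /-- coarities -/
  car : K ⊕ O → GTyp B

/-- Contexts, as lists of types whose head is the type of the most recently added variable:
`x₁ : ρ₁, …, xₙ : ρₙ` is the list `[ρₙ, …, ρ₁]`. -/
abbrev Ctx (B : Type w) : Type w := List (Typ B)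

/-- Variables of a given type in a context (typed de Bruijn indices). -/
inductive Var {B : Type w} : Ctx B → Typ B → Type w
  | here {Γ : Ctx B} {ρ : Typ B} : Var (ρ :: Γ) ρ
  | there {Γ : Ctx B} {ρ τ : Typ B} : Var Γ τ → Var (ρ :: Γ) τ

/-- Well-typed terms `Γ ⊢ M : ρ` of the `λ_c`-calculus. -/
inductive Term (S : Signature.{w, k, o}) : Ctx S.B → Typ S.B → Type (max w k o)
  | var {Γ ρ} : Var Γ ρ → Term S Γ ρ
  | const {Γ} (c : S.K) :
      Term S Γ (S.ar (.inl c)).toTyp → Term S Γ (S.car (.inl c)).toTyp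
  | op {Γ} (o : S.O) (ρ : Typ S.B) :
      Term S Γ (.prod (.arr (S.ar (.inr o)).toTyp ρ) (S.car (.inr o)).toTyp) → Term S Γ ρ
  | unit {Γ} : Term S Γ .one
  | pair {Γ ρ τ} : Term S Γ ρ → Term S Γ τ → Term S Γ (.prod ρ τ)
  | fst {Γ ρ τ} : Term S Γ (.prod ρ τ) → Term S Γ ρ
  | snd {Γ ρ τ} : Term S Γ (.prod ρ τ) → Term S Γ τ
  | absurd {Γ ρ} : Term S Γ .zero → Term S Γ ρ
  | inl {Γ ρ τ} : Term S Γ ρ → Term S Γ (.sum ρ τ)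
  | inr {Γ ρ τ} : Term S Γ τ → Term S Γ (.sum ρ τ)
  | case {Γ ρ₁ ρ₂ τ} : Term S Γ (.sum ρ₁ ρ₂) →
      Term S (ρ₁ :: Γ) τ → Term S (ρ₂ :: Γ) τ → Term S Γ τ
  | lam {Γ ρ τ} : Term S (ρ :: Γ) τ → Term S Γ (.arr ρ τ)
  | app {Γ ρ τ} : Term S Γ (.arr ρ τ) → Term S Γ ρ → Term S Γ τ

end Calculus

section Semantics

variable {C : Type u} [Category.{v} C] [CartesianMonoidalCategory C] [MonoidalClosed C]
  [ChosenCoproducts C]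

open ChosenCoproducts

/-- The interpretation of types, given a strong monad and an interpretation of base types;
function types are interpreted by `⟦ρ → τ⟧ = ⟦ρ⟧ ⇒ T ⟦τ⟧`. -/
def Typ.interp {B : Type w} (T : StrongMonad C) (A : B → C) : Typ B → C
  | .base b => A b
  | .one => 𝟙_ C
  | .prod ρ τ => ρ.interp T A ⊗ τ.interp T A
  | .zero => ChosenCoproducts.zero
  | .sum ρ τ => ChosenCoproducts.sum (ρ.interp T A) (τ.interp T A)
  | .arr ρ τ => (ρ.interp T A ⟹ T.obj (τ.interp T A))

/-- The extension of an assignment on base types to ground types by the finite products and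
coproducts of the category. -/
def GTyp.extend {B : Type w} (V : B → C) : GTyp B → C
  | .base b => V b
  | .one => 𝟙_ C
  | .prod ρ τ => ρ.extend V ⊗ τ.extend V
  | .zero => ChosenCoproducts.zero
  | .sum ρ τ => ChosenCoproducts.sum (ρ.extend V) (τ.extend V)

/-- `∏ᵢ V bᵢ`, for a list of base types listed in the order used for contexts. -/
def listProd {B : Type w} (V : B → C) : List B → C
  | [] => 𝟙_ C
  | b :: bs => listProd V bs ⊗ V b

/-- The context `x₁ : b₁, …, xₙ : bₙ` of variables of base types. -/
def baseCtx {B : Type w} (bs : List B) : Ctx B := bs.map Typ.base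

/-- A `λ_c(Σ)`-structure on the bicartesian closed category `C`. -/
structure LambdaCStructure (S : Signature.{w, k, o}) (C : Type u) [Category.{v} C]
    [CartesianMonoidalCategory C] [MonoidalClosed C] [ChosenCoproducts C] where
  /-- the strong monad -/
  T : StrongMonad C
  /-- the interpretation of base types -/
  A : S.B → C
  /-- the interpretation of effect-free constants -/
  const : ∀ c : S.K,
    (S.ar (.inl c)).toTyp.interp T A ⟶ (S.car (.inl c)).toTyp.interp T A
  /-- the interpretation of algebraic operations -/
  op : ∀ o : S.O, AlgebraicOperation T
    ((S.ar (.inr o)).toTyp.interp T A) ((S.car (.inr o)).toTyp.interp T A)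

namespace LambdaCStructure

variable {S : Signature.{w, k, o}} (𝒜 : LambdaCStructure S C)

/-- The interpretation `𝒜⟦ρ⟧` of types. -/
abbrev typ (ρ : Typ S.B) : C := ρ.interp 𝒜.T 𝒜.A

/-- The interpretation `𝒜⟦Γ⟧` of contexts: `𝒜⟦Γ, x : ρ⟧ = 𝒜⟦Γ⟧ × 𝒜⟦ρ⟧`. -/
def ctx : Ctx S.B → C
  | [] => 𝟙_ C
  | ρ :: Γ => ctx Γ ⊗ 𝒜.typ ρ

/-- The projection that interprets a variable. -/
def var : {Γ : Ctx S.B} → {ρ : Typ S.B} → Var Γ ρ → (𝒜.ctx Γ ⟶ 𝒜.typ ρ)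
  | _, _, .here => snd _ _
  | _, _, .there x => fst _ _ ≫ var x

/-- The interpretation `𝒜⟦M⟧ : 𝒜⟦Γ⟧ ⟶ T 𝒜⟦ρ⟧` of well-typed terms. -/
def term : {Γ : Ctx S.B} → {ρ : Typ S.B} → Term S Γ ρ → (𝒜.ctx Γ ⟶ 𝒜.T.obj (𝒜.typ ρ))
  | _, ρ, .var x => 𝒜.var x ≫ 𝒜.T.η.app (𝒜.typ ρ)
  | _, _, .const c M => term M ≫ 𝒜.T.map (𝒜.const c)
  | _, _, .op o ρ M =>
      term M ≫ 𝒜.T.map (unlam ((𝒜.op o).app (𝒜.typ ρ))) ≫ 𝒜.T.μ.app (𝒜.typ ρ)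
  | Γ, _, .unit => toUnit (𝒜.ctx Γ) ≫ 𝒜.T.η.app (𝟙_ C)
  | _, _, .pair (ρ := ρ) (τ := τ) M N =>
      lift (term M) (term N) ≫ 𝒜.T.dstr (𝒜.typ ρ) (𝒜.typ τ)
  | _, _, .fst (ρ := ρ) (τ := τ) M => term M ≫ 𝒜.T.map (fst (𝒜.typ ρ) (𝒜.typ τ))
  | _, _, .snd (ρ := ρ) (τ := τ) M => term M ≫ 𝒜.T.map (snd (𝒜.typ ρ) (𝒜.typ τ))
  | _, ρ, .absurd M => term M ≫ 𝒜.T.map (fromZero (𝒜.typ ρ))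
  | _, _, .inl (ρ := ρ) (τ := τ) M => term M ≫ 𝒜.T.map (inl (𝒜.typ ρ) (𝒜.typ τ))
  | _, _, .inr (ρ := ρ) (τ := τ) M => term M ≫ 𝒜.T.map (inr (𝒜.typ ρ) (𝒜.typ τ))
  | Γ, τ, .case (ρ₁ := ρ₁) (ρ₂ := ρ₂) M M₁ M₂ =>
      lift (𝟙 (𝒜.ctx Γ)) (term M) ≫ 𝒜.T.str (𝒜.ctx Γ) (𝒜.typ (.sum ρ₁ ρ₂)) ≫
        𝒜.T.map (distrib (𝒜.ctx Γ) (𝒜.typ ρ₁) (𝒜.typ ρ₂)).inv ≫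
        𝒜.T.map (cotuple (term M₁) (term M₂)) ≫ 𝒜.T.μ.app (𝒜.typ τ)
  | _, .arr ρ τ, .lam M => lam (term M) ≫ 𝒜.T.η.app (𝒜.typ (.arr ρ τ))
  | _, τ, .app (ρ := ρ) M N =>
      lift (term M) (term N) ≫ 𝒜.T.dstr (𝒜.typ (.arr ρ τ)) (𝒜.typ ρ) ≫
        𝒜.T.map (eval (𝒜.typ ρ) (𝒜.T.obj (𝒜.typ τ))) ≫ 𝒜.T.μ.app (𝒜.typ τ)

end LambdaCStructure

end Semantics

end LambdaC

open LambdaC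

/-! The relations `R` are given at ground types only and need not be closed under Kleisli extension,
so an induction on terms cannot be run with `R` itself. It is run with a ⊤⊤-lifting `D` of `T`: a
computation belongs to `D X` when every continuation from `X` into some `R σ`, with `σ` ground,
sends it into `R σ`. In the fibration `D X` is the meet over `σ` of the inverse images of `(X ⟹ R σ)
⟹ R σ` along the canonical map from `T` into the continuation monad (`exists_isTTLifting`).

Three facts carry the proof. For arbitrary `R`, the lifting is closed under unit and bind
(`above_eta`, `above_bind`), hence under all of the strong monad structure. An algebraic operation
commutes with passing a result to a continuation (`AlgebraicOperation.bind_unlam`), so (C2), which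
concerns only the `R σ`, yields the same property for every `D X` (`above_unlam_app`). By (I) the
unit is an admissible continuation, so the lifted ground relation at `σ` is contained in `R σ`
(`above_of_eta`). The first two facts and (C1) give the fundamental lemma `above_term` by induction
on terms at all types; the third brings it back to `R`. -/

namespace LambdaC

/-! ### Strong monads presented by unit and bind in context -/

namespace StrongMonad

variable {C : Type u} [Category.{v} C] [CartesianMonoidalCategory C] (T : StrongMonad C)

/-- The Kleisli extension in context: `m` followed by `k`, both in the context `L`. -/
def bind {L I J : C} (m : L ⟶ T.obj I) (k : L ⊗ I ⟶ T.obj J) : L ⟶ T.obj J :=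
  lift (𝟙 L) m ≫ T.str L I ≫ T.map k ≫ T.μ.app J

theorem whiskerRight_str {L L' : C} (s : L ⟶ L') (I : C) :
    s ▷ T.obj I ≫ T.str L' I = T.str L I ≫ T.map (s ▷ I) := by
  have h := T.str_naturality s (𝟙 I)
  simpa using h

theorem whiskerLeft_str (L : C) {I J : C} (f : I ⟶ J) :
    L ◁ T.map f ≫ T.str L J = T.str L I ≫ T.map (L ◁ f) := by
  have h := T.str_naturality (𝟙 L) f
  simpa using h

theorem lift_id_comp_str {L L' I : C} (s : L ⟶ L') (m : L ⟶ T.obj I) :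
    lift (𝟙 L) m ≫ T.str L I ≫ T.map (s ▷ I) = lift s m ≫ T.str L' I := by
  rw [← whiskerRight_str, lift_whiskerRight_assoc, Category.id_comp]

/-- Naturality in the left factor replaces `L` by the terminal object, where this is the unit law of
the strength. -/
theorem str_snd (L I : C) : T.str L I ≫ T.map (snd L I) = snd L (T.obj I) := by
  have h := congrArg (· ≫ T.map (λ_ I).hom) (T.whiskerRight_str (toUnit L) I)
  simp only [Category.assoc] at h
  rw [T.str_leftUnitor, ← T.map_comp] at h
  have h₁ : toUnit L ▷ I ≫ (λ_ I).hom = snd L I := by simp [leftUnitor_hom]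
  have h₂ : toUnit L ▷ T.obj I ≫ (λ_ (T.obj I)).hom = snd L (T.obj I) := by
    simp [leftUnitor_hom]
  rw [h₁, h₂] at h
  exact h.symm

theorem comp_bind {L L' I J : C} (s : L' ⟶ L) (m : L ⟶ T.obj I) (k : L ⊗ I ⟶ T.obj J) :
    s ≫ T.bind m k = T.bind (s ≫ m) (s ▷ I ≫ k) := by
  simp only [bind, Functor.map_comp, Category.assoc, reassoc_of% T.lift_id_comp_str, comp_lift_assoc,
    Category.comp_id]

theorem ret_bind {L I J : C} (f : L ⟶ I) (k : L ⊗ I ⟶ T.obj J) :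
    T.bind (f ≫ T.η.app I) k = lift (𝟙 L) f ≫ k := by
  have h : lift (𝟙 L) (f ≫ T.η.app I) = lift (𝟙 L) f ≫ L ◁ T.η.app I := by simp
  have h₁ := T.η.naturality k
  simp only [Functor.id_map] at h₁
  have h₂ := T.left_unit J
  rw [bind, h, Category.assoc, reassoc_of% (T.str_unit L I), ← reassoc_of% h₁, h₂]
  simp

theorem bind_snd_comp {L I J : C} (m : L ⟶ T.obj I) (f : I ⟶ T.obj J) :
    T.bind m (snd L I ≫ f) = m ≫ T.map f ≫ T.μ.app J := by
  simp [bind, reassoc_of% (T.str_snd L I)]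

theorem map_eta_mu (I : C) : T.map (T.η.app I) ≫ T.μ.app I = 𝟙 (T.obj I) := T.right_unit I

theorem bind_snd_ret {L I : C} (m : L ⟶ T.obj I) : T.bind m (snd L I ≫ T.η.app I) = m := by
  rw [bind_snd_comp, map_eta_mu, Category.comp_id]

/-- This formula and those for `μ` and `str` reduce closure of a lifting under the strong monad
structure to closure under `bind` and the unit. -/
theorem map_eq_bind {I J : C} (f : I ⟶ J) :
    T.map f = T.bind (𝟙 (T.obj I)) (snd _ _ ≫ f ≫ T.η.app J) := by
  rw [bind_snd_comp, T.map_comp, Category.assoc, map_eta_mu]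
  simp

theorem mu_eq_bind (I : C) : T.μ.app I = T.bind (𝟙 (T.obj (T.obj I))) (snd _ _) := by
  rw [← Category.comp_id (snd _ _), bind_snd_comp]
  simp

theorem str_eq_bind (I J : C) :
    T.str I J = T.bind (snd I (T.obj J)) (fst I (T.obj J) ▷ J ≫ T.η.app (I ⊗ J)) := by
  rw [bind, T.map_comp, Category.assoc, map_eta_mu, Category.comp_id, lift_id_comp_str]
  simp

theorem bind_assoc {L I J K : C} (m : L ⟶ T.obj I) (k : L ⊗ I ⟶ T.obj J)
    (k' : L ⊗ J ⟶ T.obj K) :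
    T.bind (T.bind m k) k' = T.bind m (T.bind k (fst L I ▷ J ≫ k')) := by
  -- The context is used twice, by `k` and by `k'`. Duplicating it by the diagonal lets the
  -- multiplication and associativity laws of the strength move the outer strength inside the first
  -- computation.
  have e₁ : lift (𝟙 L) (T.bind m k) ≫ T.str L J =
      lift (𝟙 L) m ≫ T.str L I ≫ T.map (lift (fst L I) k ≫ T.str L J) ≫ T.μ.app (L ⊗ J) := by
    have h₀ : lift (𝟙 L) (T.bind m k) =
        lift (lift (𝟙 L) (𝟙 L)) m ≫ (α_ L L (T.obj I)).hom ≫ L ◁ T.str L I ≫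
          L ◁ T.map k ≫ L ◁ T.μ.app J := by
      ext <;> simp [bind]
    have h₁ : lift (fst L I) k = lift (𝟙 L) (𝟙 L) ▷ I ≫ (α_ L L I).hom ≫ L ◁ k := by
      have h : lift (𝟙 L) (𝟙 L) ▷ I ≫ (α_ L L I).hom = lift (fst L I) (𝟙 (L ⊗ I)) := by
        ext <;> simp
      rw [reassoc_of% h]
      simp
    rw [h₀, h₁]
    simp only [Category.assoc, Functor.map_comp]
    rw [T.str_mult, reassoc_of% T.whiskerLeft_str, ← reassoc_of% (T.str_associator L L I),
      reassoc_of% T.lift_id_comp_str]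
  have h₂ := T.μ.naturality k'
  simp only [Functor.comp_map] at h₂
  rw [bind, reassoc_of% e₁, ← reassoc_of% h₂, T.assoc K |>.symm]
  have h₃ : T.bind k (fst L I ▷ J ≫ k') =
      lift (fst L I) k ≫ T.str L J ≫ T.map k' ≫ T.μ.app K := by
    rw [bind, T.map_comp, Category.assoc, reassoc_of% T.lift_id_comp_str]
  rw [bind, h₃]
  simp only [Functor.map_comp, Category.assoc]

end StrongMonad

/-! ### Currying, and algebraic operations against continuations -/

section Exponentials

variable {C : Type u} [Category.{v} C] [CartesianMonoidalCategory C]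

@[simp]
theorem swap_swap (X Y : C) : swap X Y ≫ swap Y X = 𝟙 (X ⊗ Y) := by
  ext <;> simp [swap]

theorem whiskerLeft_swap {X X' : C} (s : X ⟶ X') (Y : C) :
    Y ◁ s ≫ swap Y X' = swap Y X ≫ s ▷ Y := by
  ext <;> simp [swap]

variable [MonoidalClosed C]

@[simp]
theorem lam_unlam {X Y Z : C} (g : X ⟶ (Y ⟹ Z)) : lam (unlam g) = g := by
  simp [lam, unlam, reassoc_of% (swap_swap (C := C))]

@[simp]
theorem unlam_lam {X Y Z : C} (f : X ⊗ Y ⟶ Z) : unlam (lam f) = f := by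
  simp [lam, unlam, reassoc_of% (swap_swap (C := C))]

theorem comp_lam {X X' Y Z : C} (s : X' ⟶ X) (f : X ⊗ Y ⟶ Z) :
    s ≫ lam f = lam (s ▷ Y ≫ f) := by
  rw [lam, lam, ← MonoidalClosed.curry_natural_left, ← Category.assoc, ← Category.assoc,
    whiskerLeft_swap]

theorem unlam_comp {X X' Y Z : C} (s : X' ⟶ X) (g : X ⟶ (Y ⟹ Z)) :
    unlam (s ≫ g) = s ▷ Y ≫ unlam g := by
  rw [← unlam_lam (s ▷ Y ≫ unlam g), ← comp_lam, lam_unlam]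

theorem lam_comp_map {X Y Z Z' : C} (f : X ⊗ Y ⟶ Z) (h : Z ⟶ Z') :
    lam f ≫ (ihom Y).map h = lam (f ≫ h) := by
  rw [lam, lam, ← MonoidalClosed.curry_natural_right, Category.assoc]

theorem whiskerRight_eval {X Y Z : C} (g : X ⟶ (Y ⟹ Z)) : g ▷ Y ≫ eval Y Z = unlam g := by
  rw [eval, ← unlam_comp, Category.comp_id]

theorem lift_comp_unlam {X X' Y Z : C} (f : X ⟶ X') (d : X ⟶ Y) (g : X' ⟶ (Y ⟹ Z)) :
    lift f d ≫ unlam g = lift (𝟙 X) d ≫ unlam (f ≫ g) := by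
  rw [unlam_comp, lift_whiskerRight_assoc, Category.id_comp]

theorem lift_comp_homStrength {L X Y : C} (f : L ⟶ (X ⟹ Y)) :
    lift (𝟙 L) f ≫ homStrength L X Y = lam (lift (fst L X) (unlam f)) := by
  rw [homStrength, comp_lam]
  congr 1
  have h : lift (𝟙 L) f ▷ X ≫ (α_ L (X ⟹ Y) X).hom = lift (fst L X) (f ▷ X) := by
    ext <;> simp
  rw [reassoc_of% h, lift_whiskerLeft, whiskerRight_eval]

/-- Splits a bind performed under an abstraction into the three kinds of maps that the axioms of an
algebraic operation speak about: strength, `T.map k` and `μ`. The projection `fst L D` says that the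
continuation ignores the abstracted variable. -/
theorem lam_bind (T : StrongMonad C) {D L I J : C} (f : L ⟶ (D ⟹ T.obj I))
    (k : L ⊗ I ⟶ T.obj J) :
    lam (T.bind (unlam f) (fst L D ▷ I ≫ k)) =
      lift (𝟙 L) f ≫ homStrength L D (T.obj I) ≫ (ihom D).map (T.str L I) ≫
        (ihom D).map (T.map k) ≫ (ihom D).map (T.μ.app J) := by
  rw [reassoc_of% (lift_comp_homStrength f), ← Functor.map_comp, ← Functor.map_comp,
    lam_comp_map, StrongMonad.bind, T.map_comp, Category.assoc, reassoc_of% T.lift_id_comp_str]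

/-- After the splitting, the operation passes each factor by one of its axioms: `app_mult`,
`naturality` and `app_str`. -/
theorem AlgebraicOperation.lam_bind {T : StrongMonad C} {D D' L I J : C}
    (o : AlgebraicOperation T D D') (f : L ⟶ (D ⟹ T.obj I)) (k : L ⊗ I ⟶ T.obj J) :
    lam (T.bind (unlam (f ≫ o.app I)) (fst L D' ▷ I ≫ k)) =
      lam (T.bind (unlam f) (fst L D ▷ I ≫ k)) ≫ o.app J := by
  have h : lift (𝟙 L) (f ≫ o.app I) = lift (𝟙 L) f ≫ L ◁ o.app I := by simp
  rw [LambdaC.lam_bind, LambdaC.lam_bind, h]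
  simp only [Category.assoc]
  rw [o.app_mult, reassoc_of% (o.naturality k), reassoc_of% (o.app_str L I)]

/-- The continuation moves from outside the operation into each member of the family `f`, which
changes the component used from `I` to `J`. -/
theorem AlgebraicOperation.bind_unlam {T : StrongMonad C} {D D' L I J : C}
    (o : AlgebraicOperation T D D') (f : L ⟶ (D ⟹ T.obj I)) (d : L ⟶ D')
    (k : L ⊗ I ⟶ T.obj J) :
    T.bind (lift f d ≫ unlam (o.app I)) k =
      lift (lam (T.bind (unlam f) (fst L D ▷ I ≫ k))) d ≫ unlam (o.app J) := by
  have h : lift (𝟙 L) d ▷ I ≫ fst L D' ▷ I ≫ k = k := by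
    rw [← comp_whiskerRight_assoc]
    simp
  rw [lift_comp_unlam f, lift_comp_unlam (lam _), ← o.lam_bind, unlam_lam, StrongMonad.comp_bind, h]

end Exponentials

/-! ### Strict preservation of structure, expressed by liftings of morphisms -/

section Liftings

variable {E : Type u'} [Category.{v'} E] {C : Type u} [Category.{v} C] {p : E ⥤ C}

theorem eq_of_isHomLift {I J : C} {f f' : I ⟶ J} {X Y : E} {g : X ⟶ Y}
    (h : p.IsHomLift f g) (h' : p.IsHomLift f' g) : f = f' := by
  rw [IsHomLift.fac p f g, IsHomLift.fac p f' g]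

/-- Objects lie over their images only up to propositional equality, so `p.map g` may lack the
required type. Below, a universal morphism upstairs gets some image from here, which
`eq_of_isHomLift` and a universal property downstairs then identify. -/
theorem exists_isHomLift {I J : C} {X Y : E} (hX : p.obj X = I) (hY : p.obj Y = J)
    (g : X ⟶ Y) : ∃ f : I ⟶ J, p.IsHomLift f g := by
  subst hX hY
  exact ⟨p.map g, inferInstance⟩

theorem isHomLift_comp {I J K : C} {f : I ⟶ J} {g : J ⟶ K} {X Y Z : E} {f' : X ⟶ Y}
    {g' : Y ⟶ Z} (hf : p.IsHomLift f f') (hg : p.IsHomLift g g') :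
    p.IsHomLift (f ≫ g) (f' ≫ g') :=
  inferInstance

namespace Above

theorem source {I J : C} {f : I ⟶ J} {X Y : E} (h : Above p f X Y) : p.obj X = I :=
  h.elim fun g _ => IsHomLift.domain_eq p f g

theorem target {I J : C} {f : I ⟶ J} {X Y : E} (h : Above p f X Y) : p.obj Y = J :=
  h.elim fun g _ => IsHomLift.codomain_eq p f g

theorem id {I : C} {X : E} (hX : p.obj X = I) : Above p (𝟙 I) X X :=
  ⟨𝟙 X, IsHomLift.id hX⟩

theorem comp {I J K : C} {f : I ⟶ J} {g : J ⟶ K} {X Y Z : E} (hf : Above p f X Y)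
    (hg : Above p g Y Z) : Above p (f ≫ g) X Z := by
  obtain ⟨f', hf⟩ := hf
  obtain ⟨g', hg⟩ := hg
  exact ⟨f' ≫ g', inferInstance⟩

end Above

variable [CartesianMonoidalCategory E] [MonoidalClosed E] [ChosenCoproducts E]
variable [CartesianMonoidalCategory C] [MonoidalClosed C] [ChosenCoproducts C]

open ChosenCoproducts

namespace StrictlyPreservesBCC

variable (hp : StrictlyPreservesBCC p)
include hp

theorem above_fst {I J : C} {X Y : E} (hX : p.obj X = I) (hY : p.obj Y = J) :
    Above p (CartesianMonoidalCategory.fst I J) (X ⊗ Y) X := by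
  subst hX hY
  exact ⟨_, hp.fst X Y⟩

theorem above_snd {I J : C} {X Y : E} (hX : p.obj X = I) (hY : p.obj Y = J) :
    Above p (CartesianMonoidalCategory.snd I J) (X ⊗ Y) Y := by
  subst hX hY
  exact ⟨_, hp.snd X Y⟩

theorem obj_tensor {I J : C} {X Y : E} (hX : p.obj X = I) (hY : p.obj Y = J) :
    p.obj (X ⊗ Y) = I ⊗ J :=
  (hp.above_fst hX hY).source

theorem above_toUnit {I : C} {X : E} (hX : p.obj X = I) : Above p (toUnit I) X (𝟙_ E) := by
  obtain ⟨f, hf⟩ := exists_isHomLift hX hp.one (toUnit X)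
  rw [toUnit_unique (toUnit I) f]
  exact ⟨_, hf⟩

/-- Projections lie over projections, so the image of the upstairs pairing has the components `f`
and `g`. -/
theorem isHomLift_lift {I J K : C} {f : I ⟶ J} {g : I ⟶ K} {X Y Z : E} {f' : X ⟶ Y}
    {g' : X ⟶ Z} (hf : p.IsHomLift f f') (hg : p.IsHomLift g g') :
    p.IsHomLift (lift f g) (lift f' g') := by
  obtain ⟨⟩ := hf
  obtain rfl := IsHomLift.codomain_eq p g g'
  obtain ⟨h, hh⟩ := exists_isHomLift rfl (hp.obj_tensor rfl rfl) (lift f' g')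
  have h₁ := hp.fst Y Z
  have h₂ := hp.snd Y Z
  have e₁ : p.IsHomLift (h ≫ CartesianMonoidalCategory.fst _ _) f' := by
    have := isHomLift_comp hh h₁
    rwa [lift_fst] at this
  have e₂ : p.IsHomLift (h ≫ CartesianMonoidalCategory.snd _ _) g' := by
    have := isHomLift_comp hh h₂
    rwa [lift_snd] at this
  rwa [eq_of_isHomLift (IsHomLift.map p f') e₁, eq_of_isHomLift hg e₂, ← comp_lift,
    lift_fst_snd, Category.comp_id]

theorem above_lift {I J K : C} {f : I ⟶ J} {g : I ⟶ K} {X Y Z : E} (hf : Above p f X Y)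
    (hg : Above p g X Z) : Above p (lift f g) X (Y ⊗ Z) := by
  obtain ⟨f', hf⟩ := hf
  obtain ⟨g', hg⟩ := hg
  exact ⟨lift f' g', hp.isHomLift_lift hf hg⟩

theorem isHomLift_whiskerRight {I J : C} {f : I ⟶ J} {X Y : E} {f' : X ⟶ Y}
    (hf : p.IsHomLift f f') (Z : E) : p.IsHomLift (f ▷ p.obj Z) (f' ▷ Z) := by
  obtain ⟨⟩ := hf
  have h := hp.isHomLift_lift (isHomLift_comp (hp.fst X Z) (IsHomLift.map p f')) (hp.snd X Z)
  convert h using 1 <;> ext <;> simp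

theorem above_whiskerRight {I J K : C} {f : I ⟶ J} {X Y Z : E} (hf : Above p f X Y)
    (hZ : p.obj Z = K) : Above p (f ▷ K) (X ⊗ Z) (Y ⊗ Z) := by
  have h := hp.above_lift ((hp.above_fst hf.source hZ).comp hf) (hp.above_snd hf.source hZ)
  convert h using 1
  ext <;> simp

theorem above_swap {I J : C} {X Y : E} (hX : p.obj X = I) (hY : p.obj Y = J) :
    Above p (swap I J) (X ⊗ Y) (Y ⊗ X) :=
  hp.above_lift (hp.above_snd hX hY) (hp.above_fst hX hY)

theorem obj_ihom {I J : C} {X Y : E} (hX : p.obj X = I) (hY : p.obj Y = J) :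
    p.obj (X ⟹ Y) = (I ⟹ J) := by
  subst hX hY
  exact hp.exp X Y

theorem above_eval {I J : C} {X Y : E} (hX : p.obj X = I) (hY : p.obj Y = J) :
    Above p (LambdaC.eval I J) ((X ⟹ Y) ⊗ X) Y := by
  subst hX hY
  exact ⟨_, hp.eval X Y⟩

theorem above_unlam {I J K : C} {g : I ⟶ (J ⟹ K)} {X Y Z : E} (hY : p.obj Y = J)
    (hZ : p.obj Z = K) (hg : Above p g X (Y ⟹ Z)) : Above p (unlam g) (X ⊗ Y) Z := by
  rw [← whiskerRight_eval]
  exact (hp.above_whiskerRight hg hY).comp (hp.above_eval hY hZ)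

/-- Evaluation lies over evaluation, so the image of the upstairs transpose uncurries to `f`. -/
theorem above_lam {I J K : C} {f : I ⊗ J ⟶ K} {X Y Z : E} (hX : p.obj X = I)
    (hY : p.obj Y = J) (hf : Above p f (X ⊗ Y) Z) : Above p (lam f) X (Y ⟹ Z) := by
  have hZ := hf.target
  subst hX hY hZ
  obtain ⟨f', hf⟩ := hf
  obtain ⟨h, hh⟩ := exists_isHomLift rfl (hp.obj_ihom rfl rfl) (lam f')
  have e : p.IsHomLift (unlam h) f' := by
    have h₁ := hp.isHomLift_whiskerRight hh Y
    have := isHomLift_comp h₁ (hp.eval Y Z)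
    rwa [whiskerRight_eval, whiskerRight_eval, unlam_lam] at this
  rw [eq_of_isHomLift hf e, lam_unlam]
  exact ⟨_, hh⟩

theorem above_inl {I J : C} {X Y : E} (hX : p.obj X = I) (hY : p.obj Y = J) :
    Above p (ChosenCoproducts.inl I J) X (sum X Y) := by
  subst hX hY
  exact ⟨_, hp.inl X Y⟩

theorem above_inr {I J : C} {X Y : E} (hX : p.obj X = I) (hY : p.obj Y = J) :
    Above p (ChosenCoproducts.inr I J) Y (sum X Y) := by
  subst hX hY
  exact ⟨_, hp.inr X Y⟩

theorem obj_sum {I J : C} {X Y : E} (hX : p.obj X = I) (hY : p.obj Y = J) :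
    p.obj (sum X Y) = sum I J :=
  (hp.above_inl hX hY).target

theorem above_fromZero {I : C} {X : E} (hX : p.obj X = I) :
    Above p (fromZero I) ChosenCoproducts.zero X := by
  obtain ⟨f, hf⟩ := exists_isHomLift hp.zero hX (fromZero X)
  rw [isInitial.hom_ext (fromZero I) f]
  exact ⟨_, hf⟩

theorem isHomLift_cotuple {I J K : C} {f : I ⟶ K} {g : J ⟶ K} {X Y Z : E} {f' : X ⟶ Z}
    {g' : Y ⟶ Z} (hf : p.IsHomLift f f') (hg : p.IsHomLift g g') :
    p.IsHomLift (cotuple f g) (cotuple f' g') := by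
  obtain ⟨⟩ := hf
  obtain rfl := IsHomLift.domain_eq p g g'
  obtain ⟨h, hh⟩ := exists_isHomLift (hp.obj_sum rfl rfl) rfl (cotuple f' g')
  have h₁ := hp.inl X Y
  have h₂ := hp.inr X Y
  have e₁ : p.IsHomLift (ChosenCoproducts.inl _ _ ≫ h) f' := by
    have := isHomLift_comp h₁ hh
    rwa [inl_cotuple] at this
  have e₂ : p.IsHomLift (ChosenCoproducts.inr _ _ ≫ h) g' := by
    have := isHomLift_comp h₂ hh
    rwa [inr_cotuple] at this
  have e : cotuple (p.map f') g = h := by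
    apply sum_hom_ext
    · rw [inl_cotuple]
      exact eq_of_isHomLift (IsHomLift.map p f') e₁
    · rw [inr_cotuple]
      exact eq_of_isHomLift hg e₂
  rwa [e]

theorem above_cotuple {I J K : C} {f : I ⟶ K} {g : J ⟶ K} {X Y Z : E} (hf : Above p f X Z)
    (hg : Above p g Y Z) : Above p (cotuple f g) (sum X Y) Z := by
  obtain ⟨f', hf⟩ := hf
  obtain ⟨g', hg⟩ := hg
  exact ⟨cotuple f' g', hp.isHomLift_cotuple hf hg⟩

theorem isHomLift_whiskerLeft {I J : C} {f : I ⟶ J} {X Y : E} {f' : X ⟶ Y}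
    (hf : p.IsHomLift f f') (Z : E) : p.IsHomLift (p.obj Z ◁ f) (Z ◁ f') := by
  obtain ⟨⟩ := hf
  have h := hp.isHomLift_lift (hp.fst Z X) (isHomLift_comp (hp.snd Z X) (IsHomLift.map p f'))
  convert h using 1 <;> ext <;> simp

/-- The forward maps correspond under `p`, and a functor preserves inverses, which are unique. -/
theorem above_distrib_inv {I J K : C} {X Y Z : E} (hX : p.obj X = I) (hY : p.obj Y = J)
    (hZ : p.obj Z = K) :
    Above p (distrib I J K).inv (X ⊗ sum Y Z) (sum (X ⊗ Y) (X ⊗ Z)) := by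
  subst hX hY hZ
  have h : p.IsHomLift (distrib (p.obj X) (p.obj Y) (p.obj Z)).hom (distrib X Y Z).hom :=
    hp.isHomLift_cotuple (hp.isHomLift_whiskerLeft (hp.inl Y Z) X)
      (hp.isHomLift_whiskerLeft (hp.inr Y Z) X)
  obtain ⟨f, hf⟩ := exists_isHomLift (hp.obj_tensor rfl (hp.obj_sum rfl rfl))
    (hp.obj_sum (hp.obj_tensor rfl rfl) (hp.obj_tensor rfl rfl)) (distrib X Y Z).inv
  have e := isHomLift_comp h hf
  rw [Iso.hom_inv_id] at e
  have e' := eq_of_isHomLift e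
    (IsHomLift.id (hp.obj_sum (hp.obj_tensor rfl rfl) (hp.obj_tensor rfl rfl)))
  rw [← Iso.eq_inv_comp, Category.comp_id] at e'
  rw [← e']
  exact ⟨_, hf⟩

end StrictlyPreservesBCC

end Liftings

/-! ### The ⊤⊤-lifting: existence and closure properties -/

section TTLifting

variable {E : Type u'} [Category.{v'} E] {C : Type u} [Category.{v} C] {p : E ⥤ C}

theorem exists_cartesian_above [p.IsFibered] {I J : C} (f : I ⟶ J) {Y : E}
    (hY : p.obj Y = J) :
    ∃ X : E, p.obj X = I ∧ ∀ {K : C} (u : K ⟶ I) (Z : E),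
      Above p u Z X ↔ Above p (u ≫ f) Z Y := by
  refine ⟨Functor.IsPreFibered.pullbackObj hY f, Functor.IsPreFibered.pullbackObj_proj hY f,
    fun {K} u Z => ⟨?_, ?_⟩⟩
  · intro h
    exact h.comp ⟨Functor.IsPreFibered.pullbackMap hY f, inferInstance⟩
  · rintro ⟨g, hg⟩
    exact ⟨Functor.IsStronglyCartesian.map p f (Functor.IsPreFibered.pullbackMap hY f)
      (f' := u ≫ f) rfl g, inferInstance⟩

theorem above_iff_nonempty_hom_reindex [p.IsFibered] {I J : C} (f : I ⟶ J) (Z : p.Fiber I)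
    (Y : p.Fiber J) : Above p f Z.1 Y.1 ↔ Nonempty (Z ⟶ (reindex p f).obj Y) := by
  have hφ : p.IsHomLift f (Functor.IsPreFibered.pullbackMap Y.2 f) := inferInstance
  constructor
  · rintro ⟨g, hg⟩
    let g' := Functor.IsCartesian.map p f (Functor.IsPreFibered.pullbackMap Y.2 f) g
    have hg' : p.IsHomLift (𝟙 I) g' := inferInstance
    exact ⟨⟨g', hg'⟩⟩
  · rintro ⟨g⟩
    have h : Above p (𝟙 I) Z.1 (Functor.IsPreFibered.pullbackObj Y.2 f) := ⟨g.1, g.2⟩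
    have h' := h.comp ⟨_, hφ⟩
    rwa [Category.id_comp] at h'

variable [CartesianMonoidalCategory E] [MonoidalClosed E] [ChosenCoproducts E]
variable [CartesianMonoidalCategory C] [MonoidalClosed C] [ChosenCoproducts C]

/-- A fibre product is a meet for test morphisms over identities; its preservation by reindexing
extends this to test morphisms over any `u`. -/
theorem IsFibrationForLogicalRelations.exists_meet (hp : IsFibrationForLogicalRelations.{w} p)
    {J : C} {ι : Type w} (Y : ι → E) (hY : ∀ i, p.obj (Y i) = J) :
    ∃ P : E, p.obj P = J ∧ ∀ {I : C} (u : I ⟶ J) (Z : E), p.obj Z = I →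
      (Above p u Z P ↔ ∀ i, Above p u Z (Y i)) := by
  have := hp.isFibered
  have := hp.hasProducts J
  let F : ι → p.Fiber J := fun i => ⟨Y i, hY i⟩
  refine ⟨(∏ᶜ F).1, (∏ᶜ F).2, fun {I} u Z hZ => ?_⟩
  have := hp.preservesProducts u ι
  have key (Y' : p.Fiber J) := above_iff_nonempty_hom_reindex u (⟨Z, hZ⟩ : p.Fiber I) Y'
  change Above p u (⟨Z, hZ⟩ : p.Fiber I).1 _ ↔
    ∀ i, Above p u (⟨Z, hZ⟩ : p.Fiber I).1 (F i).1
  simp only [key]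
  constructor
  · rintro ⟨g⟩ i
    exact ⟨g ≫ (reindex p u).map (Pi.π F i)⟩
  · intro h
    exact ⟨(isLimitOfHasProductOfPreservesLimit (reindex p u) F).lift
      (Fan.mk _ fun i => (h i).some)⟩

/-- `D` lifts `T` to the total category as the `⊤⊤`-lifting along the objects `R i` above
`T (J i)`: a morphism factors through `D X` exactly if all of its Kleisli extensions along
morphisms into `R i` do. -/
structure IsTTLifting (T : StrongMonad C) (p : E ⥤ C) {ι : Type w} (J : ι → C) (R : ι → E)
    (D : E → E) : Prop where
  obj : ∀ {I : C} {X : E}, p.obj X = I → p.obj (D X) = T.obj I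
  above_iff : ∀ {I K : C} {X Z : E}, p.obj X = I → p.obj Z = K → ∀ u : K ⟶ T.obj I,
    (Above p u Z (D X) ↔ ∀ (i : ι) {L : C} {W : E} (v : L ⟶ K) (k : L ⊗ I ⟶ T.obj (J i)),
      Above p v W Z → Above p k (W ⊗ X) (R i) → Above p (T.bind (v ≫ u) k) W (R i))

/-- The condition on `D X` ranges over all contexts and continuations, which need not form a small
family. The exponential `X ⟹ R i` internalises them, leaving a meet over the small type `ι`. -/
theorem IsFibrationForLogicalRelations.exists_isTTLifting
    (hp : IsFibrationForLogicalRelations.{w} p) (T : StrongMonad C) {ι : Type w} {J : ι → C}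
    {R : ι → E} (hR : ∀ i, p.obj (R i) = T.obj (J i)) : ∃ D : E → E, IsTTLifting T p J R D := by
  have := hp.isFibered
  have hs := hp.strict
  suffices h : ∀ X : E, ∃ Y : E, p.obj Y = T.obj (p.obj X) ∧
      ∀ {K : C} {Z : E}, p.obj Z = K → ∀ u : K ⟶ T.obj (p.obj X),
        (Above p u Z Y ↔
          ∀ (i : ι) {L : C} {W : E} (v : L ⟶ K) (k : L ⊗ p.obj X ⟶ T.obj (J i)),
          Above p v W Z → Above p k (W ⊗ X) (R i) → Above p (T.bind (v ≫ u) k) W (R i)) by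
    choose D h₁ h₂ using h
    refine ⟨D, ?_, ?_⟩
    · rintro I X rfl
      exact h₁ X
    · rintro I K X Z rfl hZ u
      exact h₂ X hZ u
  intro X
  have hE (i : ι) : p.obj (X ⟹ R i) = (p.obj X ⟹ T.obj (J i)) := hs.obj_ihom rfl (hR i)
  -- Bind with both arguments as variables: the computation is the first, the continuation the
  -- second. Its transpose is the map from `T` to the continuation monad.
  let κ (i : ι) : T.obj (p.obj X) ⊗ (p.obj X ⟹ T.obj (J i)) ⟶ T.obj (J i) :=
    T.bind (fst _ _) (snd _ _ ▷ p.obj X ≫ eval _ _)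
  choose Y hY₁ hY₂ using fun i => exists_cartesian_above (lam (κ i))
    (hs.obj_ihom (hE i) (hR i))
  obtain ⟨P, hP₁, hP₂⟩ := hp.exists_meet Y hY₁
  refine ⟨P, hP₁, fun {K Z} hZ u => ?_⟩
  rw [hP₂ u Z hZ]
  refine forall_congr' fun i => ?_
  rw [hY₂]
  have e : unlam (u ≫ lam (κ i)) =
      T.bind (fst K (p.obj X ⟹ T.obj (J i)) ≫ u) (snd _ _ ▷ p.obj X ≫ eval _ _) := by
    rw [unlam_comp, unlam_lam, StrongMonad.comp_bind, ← comp_whiskerRight_assoc,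
      whiskerRight_fst, whiskerRight_snd]
  constructor
  -- A given continuation is a morphism `lam k` into `X ⟹ R i`; substituting it for the continuation
  -- variable recovers the bind with `k`.
  · intro h L W v k hv hk
    have h₁ := (hs.above_lift hv (hs.above_lam hv.source rfl hk)).comp
      (hs.above_unlam (hE i) (hR i) h)
    rwa [e, StrongMonad.comp_bind, ← comp_whiskerRight_assoc, lift_fst_assoc, lift_snd,
      whiskerRight_eval, unlam_lam] at h₁
  -- Conversely it suffices to test with the generic continuation, evaluation in the context `Z ⊗ (X
  -- ⟹ R i)`.
  · intro h
    rw [← lam_unlam (u ≫ lam (κ i)), e]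
    exact hs.above_lam hZ (hE i) (h _ _ (hs.above_fst hZ (hE i))
      ((hs.above_whiskerRight (hs.above_snd hZ (hE i)) rfl).comp (hs.above_eval rfl (hR i))))

namespace IsTTLifting

variable {T : StrongMonad C} {ι : Type w} {J : ι → C} {R : ι → E} {D : E → E}
  (hD : IsTTLifting T p J R D) (hp : StrictlyPreservesBCC p)
include hD hp

theorem above_eta {I : C} {X : E} (hX : p.obj X = I) : Above p (T.η.app I) X (D X) := by
  rw [hD.above_iff hX hX]
  intro i L W v k hv hk
  rw [T.ret_bind]
  exact (hp.above_lift (Above.id hv.source) hv).comp hk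

/-- By associativity, testing `bind m k` against `k'` is testing `m` against the continuation that
runs `k` and then `k'`. That continuation is admissible because `k` passes its own test in the
context extended by `X`. -/
theorem above_bind {I I' K : C} {X X' Z : E} {m : K ⟶ T.obj I} {k : K ⊗ I ⟶ T.obj I'}
    (hX : p.obj X = I) (hX' : p.obj X' = I') (hm : Above p m Z (D X))
    (hk : Above p k (Z ⊗ X) (D X')) : Above p (T.bind m k) Z (D X') := by
  rw [hD.above_iff hX' hm.source]
  intro i L W v k' hv hk'
  rw [T.comp_bind, T.bind_assoc]
  refine (hD.above_iff hX hm.source m).1 hm i _ _ hv ?_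
  refine (hD.above_iff hX' hk.source k).1 hk i _ _ (hp.above_whiskerRight hv hX) ?_
  exact (hp.above_whiskerRight (hp.above_fst hv.source hX) hX').comp hk'

theorem above_map {I I' : C} {X X' : E} {f : I ⟶ I'} (hf : Above p f X X') :
    Above p (T.map f) (D X) (D X') := by
  rw [T.map_eq_bind]
  exact hD.above_bind hp hf.source hf.target (Above.id (hD.obj hf.source))
    ((hp.above_snd (hD.obj hf.source) hf.source).comp (hf.comp (hD.above_eta hp hf.target)))

theorem above_mu {I : C} {X : E} (hX : p.obj X = I) :
    Above p (T.μ.app I) (D (D X)) (D X) := by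
  have h := hD.obj hX
  rw [T.mu_eq_bind]
  exact hD.above_bind hp h hX (Above.id (hD.obj h)) (hp.above_snd (hD.obj h) h)

theorem above_str {I I' : C} {X X' : E} (hX : p.obj X = I) (hX' : p.obj X' = I') :
    Above p (T.str I I') (X ⊗ D X') (D (X ⊗ X')) := by
  have h := hp.obj_tensor hX hX'
  rw [T.str_eq_bind]
  exact hD.above_bind hp hX' h (hp.above_snd hX (hD.obj hX'))
    ((hp.above_whiskerRight (hp.above_fst hX (hD.obj hX')) hX').comp (hD.above_eta hp h))

theorem above_dstr {I I' : C} {X X' : E} (hX : p.obj X = I) (hX' : p.obj X' = I') :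
    Above p (T.dstr I I') (D X ⊗ D X') (D (X ⊗ X')) :=
  (hp.above_swap (hD.obj hX) (hD.obj hX')).comp <|
    (hD.above_str hp (hD.obj hX') hX).comp <|
    (hD.above_map hp (hp.above_swap (hD.obj hX') hX)).comp <|
    (hD.above_map hp (hD.above_str hp hX hX')).comp (hD.above_mu hp (hp.obj_tensor hX hX'))

theorem above_unlam_app {A A' I : C} {P P' X : E} (o : AlgebraicOperation T A A')
    (hP : p.obj P = A) (hP' : p.obj P' = A') (hX : p.obj X = I)
    (hR : ∀ i, p.obj (R i) = T.obj (J i))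
    (ho : ∀ i, Above p (o.app (J i)) (P ⟹ R i) (P' ⟹ R i)) :
    Above p (unlam (o.app I)) ((P ⟹ D X) ⊗ P') (D X) := by
  have hDX := hD.obj hX
  have hE := hp.obj_ihom hP hDX
  rw [hD.above_iff hX (hp.obj_tensor hE hP')]
  intro i L W v k hv hk
  have hf := hv.comp (hp.above_fst hE hP')
  have hd := hv.comp (hp.above_snd hE hP')
  -- Separates the family of computations from the parameter, so that `bind_unlam` applies.
  have hv' : v = lift (v ≫ fst _ _) (v ≫ snd _ _) := by ext <;> simp
  rw [hv', o.bind_unlam]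
  refine (hp.above_lift (hp.above_lam hv.source hP ?_) hd).comp
    (hp.above_unlam hP' (hR i) (ho i))
  have hu := hp.above_unlam hP hDX hf
  -- What remains is that every member of the family passes the test `k`, which is its membership in
  -- `D X` in the context `W ⊗ P`.
  rw [← Category.id_comp (unlam (v ≫ fst _ _))]
  exact (hD.above_iff hX hu.source _).1 hu i _ _ (Above.id hu.source)
    ((hp.above_whiskerRight (hp.above_fst hv.source hP) hX).comp hk)

/-- Testing against the unit as continuation returns `m` itself, by the right unit law. -/
theorem above_of_eta {i : ι} {K : C} {X Z : E} {m : K ⟶ T.obj (J i)}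
    (hη : Above p (T.η.app (J i)) X (R i)) (hm : Above p m Z (D X)) : Above p m Z (R i) := by
  have h := (hD.above_iff hη.source hm.source m).1 hm i _ _ (Above.id hm.source)
    ((hp.above_snd hm.source hη.source).comp hη)
  rw [Category.id_comp] at h
  rw [← T.bind_snd_ret m]
  exact h

end IsTTLifting

end TTLifting

/-! ### The logical relation and its fundamental lemma -/

section LogicalRelation

variable {E : Type u'} [Category.{v'} E] [CartesianMonoidalCategory E] [MonoidalClosed E]
  [ChosenCoproducts E]

/-- The logical relation at each type, given the relations at base types and a lifting `D` of the
monad: `⟦ρ → τ⟧ = ⟦ρ⟧ ⇒ D ⟦τ⟧`. -/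
def Typ.rel {B : Type w} (V : B → E) (D : E → E) : Typ B → E
  | .base b => V b
  | .one => 𝟙_ E
  | .prod ρ τ => ρ.rel V D ⊗ τ.rel V D
  | .zero => ChosenCoproducts.zero
  | .sum ρ τ => ChosenCoproducts.sum (ρ.rel V D) (τ.rel V D)
  | .arr ρ τ => (ρ.rel V D ⟹ D (τ.rel V D))

/-- The logical relation at contexts. -/
def ctxRel {B : Type w} (V : B → E) (D : E → E) : Ctx B → E
  | [] => 𝟙_ E
  | ρ :: Γ => ctxRel V D Γ ⊗ ρ.rel V D

/-- The lifting enters only at arrow types, so the ground relations do not depend on `D`. This is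
why (C1) and (C2), stated without `D`, can be used in the induction. -/
theorem GTyp.rel_toTyp {B : Type w} (V : B → E) (D : E → E) (ρ : GTyp B) :
    ρ.toTyp.rel V D = ρ.extend V := by
  induction ρ with
  | base b => rfl
  | one => rfl
  | prod ρ τ h₁ h₂ => simp only [toTyp, Typ.rel, extend, h₁, h₂]
  | zero => rfl
  | sum ρ τ h₁ h₂ => simp only [toTyp, Typ.rel, extend, h₁, h₂]

theorem ctxRel_baseCtx {B : Type w} (V : B → E) (D : E → E) (bs : List B) :
    ctxRel V D (baseCtx bs) = listProd V bs := by
  induction bs with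
  | nil => rfl
  | cons b bs h => exact congrArg (· ⊗ V b) h

variable {S : Signature.{w, k, o}} {C : Type u} [Category.{v} C] [CartesianMonoidalCategory C]
  [MonoidalClosed C] [ChosenCoproducts C] {𝒜 : LambdaCStructure S C} {p : E ⥤ C}
  {ι : Type w} {J : ι → C} {R : ι → E} {D : E → E} {V : S.B → E}

theorem IsTTLifting.obj_rel (hD : IsTTLifting 𝒜.T p J R D) (hp : StrictlyPreservesBCC p)
    (hV : ∀ b, p.obj (V b) = 𝒜.A b) (ρ : Typ S.B) : p.obj (ρ.rel V D) = 𝒜.typ ρ := by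
  induction ρ with
  | base b => exact hV b
  | one => exact hp.one
  | prod ρ τ h₁ h₂ => exact hp.obj_tensor h₁ h₂
  | zero => exact hp.zero
  | sum ρ τ h₁ h₂ => exact hp.obj_sum h₁ h₂
  | arr ρ τ h₁ h₂ => exact hp.obj_ihom h₁ (hD.obj h₂)

theorem IsTTLifting.obj_ctxRel (hD : IsTTLifting 𝒜.T p J R D) (hp : StrictlyPreservesBCC p)
    (hV : ∀ b, p.obj (V b) = 𝒜.A b) (Γ : Ctx S.B) : p.obj (ctxRel V D Γ) = 𝒜.ctx Γ := by
  induction Γ with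
  | nil => exact hp.one
  | cons ρ Γ h => exact hp.obj_tensor h (hD.obj_rel hp hV ρ)

theorem IsTTLifting.above_var (hD : IsTTLifting 𝒜.T p J R D) (hp : StrictlyPreservesBCC p)
    (hV : ∀ b, p.obj (V b) = 𝒜.A b) {Γ : Ctx S.B} {ρ : Typ S.B} (x : Var Γ ρ) :
    Above p (𝒜.var x) (ctxRel V D Γ) (ρ.rel V D) := by
  induction x with
  | here => exact hp.above_snd (hD.obj_ctxRel hp hV _) (hD.obj_rel hp hV _)
  | there x h =>
    exact (hp.above_fst (hD.obj_ctxRel hp hV _) (hD.obj_rel hp hV _)).comp h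

/-- The fundamental lemma of logical relations for the `⊤⊤`-lifting. -/
theorem IsTTLifting.above_term (hD : IsTTLifting 𝒜.T p J R D) (hp : StrictlyPreservesBCC p)
    (hV : ∀ b, p.obj (V b) = 𝒜.A b) (hR : ∀ i, p.obj (R i) = 𝒜.T.obj (J i))
    (hconst : ∀ c : S.K,
      Above p (𝒜.const c) ((S.ar (.inl c)).extend V) ((S.car (.inl c)).extend V))
    (hop : ∀ (o : S.O) (i : ι), Above p ((𝒜.op o).app (J i))
      ((S.ar (.inr o)).extend V ⟹ R i) ((S.car (.inr o)).extend V ⟹ R i))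
    {Γ : Ctx S.B} {ρ : Typ S.B} (M : Term S Γ ρ) :
    Above p (𝒜.term M) (ctxRel V D Γ) (D (ρ.rel V D)) := by
  have ht := hD.obj_rel hp hV
  have hc := hD.obj_ctxRel hp hV
  induction M with
  | var x => exact (hD.above_var hp hV x).comp (hD.above_eta hp (ht _))
  | const c M h =>
    refine h.comp (hD.above_map hp ?_)
    rw [GTyp.rel_toTyp, GTyp.rel_toTyp]
    exact hconst c
  | op o ρ M h =>
    refine h.comp ((hD.above_map hp ?_).comp (hD.above_mu hp (ht ρ)))
    refine hD.above_unlam_app hp (𝒜.op o) (ht _) (ht _) (ht ρ) hR fun i => ?_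
    rw [GTyp.rel_toTyp, GTyp.rel_toTyp]
    exact hop o i
  | unit => exact (hp.above_toUnit (hc _)).comp (hD.above_eta hp hp.one)
  | pair M N h₁ h₂ => exact (hp.above_lift h₁ h₂).comp (hD.above_dstr hp (ht _) (ht _))
  | fst M h => exact h.comp (hD.above_map hp (hp.above_fst (ht _) (ht _)))
  | snd M h => exact h.comp (hD.above_map hp (hp.above_snd (ht _) (ht _)))
  | absurd M h => exact h.comp (hD.above_map hp (hp.above_fromZero (ht _)))
  | inl M h => exact h.comp (hD.above_map hp (hp.above_inl (ht _) (ht _)))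
  | inr M h => exact h.comp (hD.above_map hp (hp.above_inr (ht _) (ht _)))
  | case M M₁ M₂ h h₁ h₂ =>
    exact (hp.above_lift (Above.id (hc _)) h).comp <| (hD.above_str hp (hc _) (ht _)).comp <|
      (hD.above_map hp (hp.above_distrib_inv (hc _) (ht _) (ht _))).comp <|
      (hD.above_map hp (hp.above_cotuple h₁ h₂)).comp (hD.above_mu hp (ht _))
  | lam M h => exact (hp.above_lam (hc _) (ht _) h).comp (hD.above_eta hp (ht (.arr _ _)))
  | app M N h₁ h₂ =>
    exact (hp.above_lift h₁ h₂).comp <| (hD.above_dstr hp (ht (.arr _ _)) (ht _)).comp <|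
      (hD.above_map hp (hp.above_eval (ht _) (hD.obj (ht _)))).comp (hD.above_mu hp (ht _))

end LogicalRelation

end LambdaC

open LambdaC
theorem mainTheorem4 {S : Signature.{w, k, o}}
    {C : Type u} [Category.{v} C] [CartesianMonoidalCategory C] [MonoidalClosed C]
    [ChosenCoproducts C]
    {E : Type u'} [Category.{v'} E] [CartesianMonoidalCategory E] [MonoidalClosed E]
    [ChosenCoproducts E]
    (𝒜 : LambdaCStructure S C) (p : E ⥤ C) (hp : IsFibrationForLogicalRelations.{w} p)
    (V : S.B → E) (hV : ∀ b, p.obj (V b) = 𝒜.A b)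
    (R : GTyp S.B → E) (hR : ∀ ρ, p.obj (R ρ) = 𝒜.T.obj (𝒜.typ ρ.toTyp))
    (hI : ∀ ρ : GTyp S.B, Above p (𝒜.T.η.app (𝒜.typ ρ.toTyp)) (ρ.extend V) (R ρ))
    (hC1 : ∀ c : S.K,
      Above p (𝒜.const c) ((S.ar (.inl c)).extend V) ((S.car (.inl c)).extend V))
    (hC2 : ∀ (o : S.O) (ρ : GTyp S.B),
      Above p ((𝒜.op o).app (𝒜.typ ρ.toTyp))
        ((S.ar (.inr o)).extend V ⟹ R ρ) ((S.car (.inr o)).extend V ⟹ R ρ))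
    (bs : List S.B) (ρ : GTyp S.B) (M : Term S (baseCtx bs) ρ.toTyp) :
    Above p (𝒜.term M) (listProd V bs) (R ρ) := by
  -- The index type of the tests is `GTyp S.B`, which lies in the universe `w` of the small fibre
  -- products.
  obtain ⟨D, hD⟩ := hp.exists_isTTLifting 𝒜.T hR
  have h := hD.above_term hp.strict hV hR hC1 hC2 M
  rw [ctxRel_baseCtx, GTyp.rel_toTyp] at h
  exact hD.above_of_eta hp.strict (hI ρ) h
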